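/- Let $1\le d<n$ be integers, $G=\mathrm{SL}_{n+1}(\mathbb R)$, $\Gamma=\mathrm{SL}_{n+1}(\mathbb Z)$, and let all norms be sup norms. For $A\in\mathrm{Mat}_{d+1,n-d}(\mathbb R)$ let $\omega(A)$ be the supremum of the real numbers $\omega$ such that $\|A\mathbf q-\mathbf p\|\le\|\mathbf q\|^{-\omega}$ has infinitely many solutions $\mathbf q\in\mathbb Z^{n-d}\setminus\{0\}$, $\mathbf p\in\mathbb Z^{d+1}$. Put $$u_A=\begin{pmatrix}I_{d+1}&A\\0&I_{n-d}\end{pmatrix},\qquad y_A=u_A\Gamma\in G/\Gamma,\qquad b_t=\begin{pmatrix}e^{\frac{n-d}{(d+1)(n+1)}t}I_{d+1}&0\\0&e^{-\frac{1}{n+1}t}I_{n-d}\end{pmatrix}.$$ Let $e_0,\dots,e_n$ be the standard basis of $\mathbb R^{n+1}$. Equip $\Lambda^k\mathbb R^{n+1}$ with the sup norm with respect to the basis of the $e_J=e_{j_1}\wedge\cdots\wedge e_{j_k}$, $J=\{j_1<\cdots<j_k\}$, and let $\pi_i$ be the coordinate projection of $\Lambda^k\mathbb R^{n+1}$ onto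 the span of those $e_J$ for which exactly $i$ elements of $J$ lie in $\{0,\dots,d\}$; put $\pi_{\mathrm{fix}}=\pi_0+\pi_{d+1}$ and $\delta_k=(n+1-k)k$. For $\varepsilon>0$, $1\le k\le n$ and $v\in\Lambda^k\mathbb R^{n+1}$ let $$\varphi_\varepsilon(v)=\begin{cases}\min_{1\le i\le d}\varepsilon^{\frac{d+1}{d+1-i}\delta_k}\|\pi_i(v)\|^{-\frac{d+1}{d+1-i}},&\|\pi_{\mathrm{fix}}(v)\|<\varepsilon^{\delta_k},\\0,&\text{otherwise,}\end{cases}$$ a negative power of $0$ being $+\infty$. For $0<\theta<\frac d{d+1}$ and $y=g\Gamma\in G/\Gamma$ let $\alpha(y)=\alpha_\varepsilon^\theta(y)\in[0,\infty]$ be the supremum of $\varphi_\varepsilon(v)^\theta$ over all $v=g(v_1\wedge\cdots\wedge v_k)$ with $1\le k\le n$ and $v_1,\dots,v_k\in\mathbb Z^{n+1}$ linearly independent, and let $$\rho(y)=\limsup_{t\to\infty}\frac{\log\alpha(b_ty)}{t}\in[-\infty,+\infty].$$ **Proposition.** Let $0<\theta<\frac{d}{d+1}$ and $\varepsilon>0$,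 and let $A\in\mathrm{Mat}_{d+1,n-d}(\mathbb R)$ satisfy $\omega(A)<n$. Then $\frac{n-d}{d+1}\le\omega(A)<n$ and $$\rho(y_A)\le\begin{cases}\dfrac{n(d+1)\left(\omega(A)-\frac{n-d}{d+1}\right)}{\left(1+(d+1)\omega(A)-(n-d)\right)(n+1)}\,\theta,&\text{if }\frac{n-d}{d+1}\le\omega(A)<n-1,\\[3ex]\left(\omega(A)-\frac{n-d}{d+1}\right)\dfrac{d+1}{d(n+1)}\,\theta,&\text{if }n-1\le\omega(A)<n.\end{cases}$$ -/

import Mathlib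

open scoped ENNReal
open Filter Module

noncomputable section

namespace AffineSing

/-- The Diophantine exponent of a real `r × s` matrix `A`: the supremum in `[-∞, +∞]` of the real
numbers `w` such that `‖A q - p‖ ≤ ‖q‖ ^ (-w)` has infinitely many solutions
`q ∈ ℤ^s ∖ {0}`, `p ∈ ℤ^r`. The norms are sup norms. -/
def diophExp {r s : ℕ} (A : Matrix (Fin r) (Fin s) ℝ) : EReal :=
  sSup ((fun w : ℝ => (w : EReal)) ''
    {w : ℝ | {x : (Fin s → ℤ) × (Fin r → ℤ) | x.1 ≠ 0 ∧
      ‖A.mulVec (fun j => (x.1 j : ℝ)) - (fun i => (x.2 i : ℝ))‖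
        ≤ ‖(fun j => (x.1 j : ℝ))‖ ^ (-w)}.Infinite})

/-- `G = SL_{n+1}(ℝ)`, with rows and columns indexed by `0, …, n`. -/
abbrev G (n : ℕ) : Type := Matrix.SpecialLinearGroup (Fin (n + 1)) ℝ

/-- `Γ = SL_{n+1}(ℤ)`, as a subgroup of `G`. -/
def Gam (n : ℕ) : Subgroup (G n) :=
  (Matrix.SpecialLinearGroup.map (Int.castRingHom ℝ)).range

/-- `X_{n+1} = G/Γ`, the space of unimodular lattices in `ℝ^{n+1}`. -/
abbrev X (n : ℕ) : Type := G n ⧸ Gam n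

/-- The splitting of the indices `0, …, n` into the blocks `0, …, d` and `d+1, …, n`. -/
def blockEquiv {d n : ℕ} (h : d < n) : Fin (d + 1) ⊕ Fin (n - d) ≃ Fin (n + 1) :=
  finSumFinEquiv.trans (finCongr (by omega))

/-- `u_A`, the block matrix `(I_{d+1}, A; 0, I_{n-d})`. -/
def uA {d n : ℕ} (h : d < n) (A : Matrix (Fin (d + 1)) (Fin (n - d)) ℝ) : G n :=
  ⟨Matrix.reindex (blockEquiv h) (blockEquiv h) (Matrix.fromBlocks 1 A 0 1), by
    rw [Matrix.det_reindex_self, Matrix.det_fromBlocks_zero₂₁]; simp⟩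

/-- `b_t`, the block diagonal matrix with blocks `e^{(n-d)t/((d+1)(n+1))} I_{d+1}` and
`e^{-t/(n+1)} I_{n-d}`. -/
def bt {d n : ℕ} (h : d < n) (t : ℝ) : G n :=
  ⟨Matrix.reindex (blockEquiv h) (blockEquiv h) (Matrix.fromBlocks
      (Real.exp (((n : ℝ) - d) / (((d : ℝ) + 1) * ((n : ℝ) + 1)) * t) • 1) 0
      0 (Real.exp (-(1 / ((n : ℝ) + 1)) * t) • 1)), by
    rw [Matrix.det_reindex_self, Matrix.det_fromBlocks_zero₂₁, Matrix.det_smul, Matrix.det_smul]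
    simp only [Fintype.card_fin, Matrix.det_one, mul_one]
    rw [← Real.exp_nat_mul, ← Real.exp_nat_mul, ← Real.exp_add, Real.exp_eq_one_iff,
      Nat.cast_sub h.le]
    push_cast
    field_simp
    ring⟩

/-- The set `g ℤ^{n+1}`. -/
def latticeOf {n : ℕ} (g : G n) : Set (Fin (n + 1) → ℝ) :=
  Set.range fun z : Fin (n + 1) → ℤ => g.1.mulVec (fun i => (z i : ℝ))

theorem latticeOf_mul_subset {n : ℕ} (g : G n) {c : G n} (hc : c ∈ Gam n) :
    latticeOf (g * c) ⊆ latticeOf g := by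
  obtain ⟨γ, rfl⟩ := hc
  rintro _ ⟨z, rfl⟩
  refine ⟨γ.1.mulVec z, ?_⟩
  simp only [Matrix.SpecialLinearGroup.coe_mul, ← Matrix.mulVec_mulVec]
  congr 1
  funext i
  simp [Matrix.mulVec, dotProduct]

/-- The lattice `g ℤ^{n+1}` attached to the point `y = gΓ` of `G/Γ`. -/
def lattice {n : ℕ} (y : X n) : Set (Fin (n + 1) → ℝ) :=
  Quotient.liftOn' y latticeOf (by
    intro g g' hgg
    have hm : g⁻¹ * g' ∈ Gam n := QuotientGroup.leftRel_apply.mp hgg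
    apply Set.Subset.antisymm
    · simpa using latticeOf_mul_subset g' ((Gam n).inv_mem hm)
    · simpa using latticeOf_mul_subset g hm)

/-- The exterior power `Λ^k ℝ^{n+1}`. -/
abbrev Lam (n k : ℕ) : Type := ⋀[ℝ]^k (Fin (n + 1) → ℝ)

/-- The basis `e_J = e_{j_1} ∧ ⋯ ∧ e_{j_k}`, `J = {j_1 < ⋯ < j_k} ⊆ {0, …, n}`, of
`Λ^k ℝ^{n+1}`. -/
def eBasis (n k : ℕ) : Basis (Set.powersetCard (Fin (n + 1)) k) ℝ (Lam n k) :=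
  (Pi.basisFun ℝ (Fin (n + 1))).exteriorPower k

/-- The sup norm on `Λ^k ℝ^{n+1}` with respect to the basis `e_J`. -/
def supNorm {n k : ℕ} (v : Lam n k) : ℝ :=
  ⨆ J : Set.powersetCard (Fin (n + 1)) k, |(eBasis n k).repr v J|

/-- The projection `π_i` of `Λ^k ℝ^{n+1}` onto `Λ^i(V_0^⊥) ⊗ Λ^{k-i} V_0`, where `V_0^⊥` is
spanned by `e_0, …, e_d` and `V_0` by `e_{d+1}, …, e_n`. This summand is spanned by the `e_J`
with exactly `i` elements of `J` in `{0, …, d}`. It is `0` when there are no such `J`. -/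
def proj {n k : ℕ} (d i : ℕ) : Lam n k →ₗ[ℝ] Lam n k :=
  (eBasis n k).constr ℝ fun J =>
    if (J.1.filter fun j : Fin (n + 1) => (j : ℕ) ≤ d).card = i then eBasis n k J else 0

/-- The projection `π_fix = π_0 ⊕ π_{d+1}` onto the vectors fixed by `H_d`. -/
def projFix {n k : ℕ} (d : ℕ) : Lam n k →ₗ[ℝ] Lam n k := proj d 0 + proj d (d + 1)

/-- `δ_k = (n + 1 - k) k`. -/
def del (n k : ℕ) : ℝ := ((n : ℝ) + 1 - k) * k

open Classical in
/-- The function `φ_ε : Λ^k ℝ^{n+1} → [0, ∞]`. Powers are taken in `[0, ∞]`, so that a negative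
power of `0` is `∞`: indices `i` with `π_i(v) = 0` do not contribute to the minimum. -/
def phi {n k : ℕ} (d : ℕ) (ε : ℝ) (v : Lam n k) : ℝ≥0∞ :=
  if supNorm (projFix d v) < ε ^ del n k then
    ⨅ i ∈ Finset.Icc 1 d,
      ENNReal.ofReal (ε ^ (((d : ℝ) + 1) / ((d : ℝ) + 1 - i) * del n k)) *
        ENNReal.ofReal (supNorm (proj d i v)) ^ (-(((d : ℝ) + 1) / ((d : ℝ) + 1 - i)))
  else 0

/-- The height function `α_ε^θ : G/Γ → [0, ∞]`, the supremum of `φ_ε(v)^θ` over the nonzero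
`y`-integral decomposable vectors `v = w_1 ∧ ⋯ ∧ w_k`, `1 ≤ k ≤ n`, with `w_1, …, w_k` linearly
independent in the lattice of `y`. -/
def alpha {n : ℕ} (d : ℕ) (ε θ : ℝ) (y : X n) : ℝ≥0∞ :=
  ⨆ (k : ℕ) (_ : 1 ≤ k ∧ k ≤ n) (w : Fin k → Fin (n + 1) → ℝ)
    (_ : (∀ j, w j ∈ lattice y) ∧ LinearIndependent ℝ w),
    phi d ε (exteriorPower.ιMulti ℝ k w) ^ θ

/-- The exponent `ρ(y) = limsup_{t → ∞} log α(b_t y) / t`, in `[-∞, +∞]`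
(with `log 0 = -∞`, `log ∞ = +∞`). -/
def rho {d n : ℕ} (h : d < n) (ε θ : ℝ) (y : X n) : EReal :=
  limsup (fun t : ℝ => ENNReal.log (alpha d ε θ (bt h t • y)) / (t : EReal)) atTop

end AffineSing

end

/-! Fix `w > ω(A)` and put `s = (d+1)w - (n-d)`. Since `w` exceeds the exponent, a nonzero vector of
`u_A ℤ^{n+1}` whose lower coordinates are at most `Q ≥ 1` has some upper coordinate of size at least
`c Q^{-w}`. The height is bounded by showing that, for large `t`, `φ_ε(v) > e^{Rt}` would produce a
lattice vector violating this. Let `v` come from `x_1, …, x_k` in `u_A ℤ^{n+1}` by applying `b_t`.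
The inequality `φ_ε(v) > e^{Rt}` makes the `i`-th component of `v` at most a constant times
`e^{-R(1-i/(d+1))t}` for `1 ≤ i ≤ d+1`, while `π_0(v)` is merely bounded. If `π_0(v)` also obeyed
this law, moving back to time `(1-R)t` would give every coordinate the same bound
`e^{-R(1-k/(n+1))t}`, so the sublattice would have small covolume. Minkowski's theorem would then
give a short vector, which is impossible once `R > ns/((1+s)(n+1))` (`eventually_exists_lt_minor`).
Hence `π_0` is nonzero. Let `V` be its largest coordinate on `x_1 ∧ ⋯ ∧ x_k`, and let `P` bound the
coordinates of `π_1`. Then `V` is at least of order `e^{(k/(n+1)-R)t}` and at most of order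
`e^{kt/(n+1)}`. Minkowski on the `k` lower coordinates realizing `V`, with Cramer's rule for the
others, gives a lattice vector with lower part of order `V^{1/k}` and upper part of order `V^{1/k}
P/V`. So `P` is at least of order `V^{1-(1+w)/k}` (`exists_pos_forall_mul_rpow_le`). If `k ≤ 1+w`,
the upper bound on `V` contradicts this when `R > s/(d(n+1))`. If `k > 1+w`, the lower bound does so
under the first condition on `R`. Letting `w` decrease to `ω` bounds `ρ` by `θ` times the larger of
the two rates, and these cross at `ω = n-1`. -/

noncomputable section

namespace AffineSing

/-! ### Minkowski's theorem and Cramer's rule for sublattices -/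

/-- The minor of the family `w` along the rows `f`. -/
def minor {ι : Type*} {k : ℕ} (w : Fin k → ι → ℝ) (f : Fin k → ι) : ℝ :=
  (Matrix.of fun i j => w i (f j)).det

/-- Minkowski's theorem for the lattice spanned by the rows of an invertible matrix. -/
theorem exists_int_combination_norm_le {k : ℕ} (hk : 0 < k) (M : Matrix (Fin k) (Fin k) ℝ)
    (hM : M.det ≠ 0) :
    ∃ c : Fin k → ℤ, c ≠ 0 ∧
      ∀ j, |∑ i, (c i : ℝ) * M i j| ≤ |M.det| ^ (1 / (k : ℝ)) := by
  have : Nonempty (Fin k) := ⟨⟨0, hk⟩⟩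
  have hli : LinearIndependent ℝ M.row := Matrix.linearIndependent_rows_of_det_ne_zero hM
  let b : Basis (Fin k) ℝ (Fin k → ℝ) :=
    basisOfLinearIndependentOfCardEqFinrank hli (by simp)
  have hb : ∀ i, b i = M i := fun i => by simp [b]; rfl
  set r : ℝ := |M.det| ^ (1 / (k : ℝ)) with hr
  have hr0 : 0 ≤ r := by positivity
  have hvol := ZSpan.volume_fundamentalDomain b
  have hbM : Matrix.of b = M := by ext i j; simp [hb]
  rw [hbM] at hvol
  have fund := ZSpan.isAddFundamentalDomain b MeasureTheory.volume
  have : Countable (Submodule.span ℤ (Set.range b)).toAddSubgroup :=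
    inferInstanceAs (Countable (Submodule.span ℤ (Set.range b)))
  have : DiscreteTopology (Submodule.span ℤ (Set.range b)).toAddSubgroup :=
    inferInstanceAs (DiscreteTopology (Submodule.span ℤ (Set.range b)))
  -- The closed ball of radius `r` has volume `(2r)^k = 2^k |det M|`, the equality case of
  -- Minkowski's theorem, which compactness permits.
  obtain ⟨x, hx0, hx⟩ :=
    MeasureTheory.exists_ne_zero_mem_lattice_of_measure_mul_two_pow_le_measure
      (L := (Submodule.span ℤ (Set.range b)).toAddSubgroup) (s := Metric.closedBall 0 r) fund
      (by simp) (convex_closedBall 0 r) (isCompact_closedBall 0 r)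
      (by
        rw [hvol, Real.volume_pi_closedBall _ hr0]
        simp only [Module.finrank_fintype_fun_eq_card, Fintype.card_fin]
        rw [mul_pow, hr, ← Real.rpow_mul_natCast (abs_nonneg _), one_div,
          inv_mul_cancel₀ (by positivity), Real.rpow_one, mul_comm,
          ENNReal.ofReal_mul (by positivity), ENNReal.ofReal_pow (by norm_num)]
        simp)
  obtain ⟨c, hc⟩ := (Submodule.mem_span_range_iff_exists_fun ℤ).1 x.2
  refine ⟨c, ?_, fun j => ?_⟩
  · rintro rfl
    apply hx0
    ext1
    rw [← hc]; simp
  · have h1 : ‖(x : Fin k → ℝ)‖ ≤ r := by simpa using hx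
    have h2 := (norm_le_pi_norm (x : Fin k → ℝ) j).trans h1
    rw [← hc] at h2
    simpa [hb] using h2

/-- Cramer's rule: on the span of the family, the coordinate `l` is a linear combination of the
coordinates `f a`, whose coefficients are ratios of minors. -/
theorem sum_mul_minor_update {ι : Type*} [DecidableEq ι] {k : ℕ} (w : Fin k → ι → ℝ)
    (f : Fin k → ι) (c : Fin k → ℝ) (l : ι) :
    (∑ i, c i * w i l) * minor w f =
      ∑ a, (∑ i, c i * w i (f a)) * minor w (Function.update f a l) := by
  set M : Matrix (Fin k) (Fin k) ℝ := Matrix.of fun i j => w i (f j) with hMdef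
  have h1 : ∀ a, minor w (Function.update f a l) = M.cramer (fun i => w i l) a := by
    intro a
    rw [Matrix.cramer_apply, minor]
    congr 1
    ext i j
    by_cases h : j = a
    · subst h; simp
    · simp [h, hMdef]
  have h2 : (M.mulVec (M.cramer fun i => w i l)) = M.det • fun i => w i l :=
    Matrix.mulVec_cramer _ _
  have h3 : ∀ i, ∑ a, w i (f a) * minor w (Function.update f a l) = minor w f * w i l := by
    intro i
    have := congrFun h2 i
    simp only [h1]
    simpa [Matrix.mulVec, dotProduct, hMdef, minor] using this
  simp only [Finset.sum_mul]
  rw [Finset.sum_comm]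
  refine Finset.sum_congr rfl fun i _ => ?_
  rw [mul_assoc, mul_comm (w i l), ← h3, Finset.mul_sum]
  exact Finset.sum_congr rfl fun a _ => by ring

/-- Minkowski controls the coordinates along `f`, and Cramer's rule carries the control to every
`l`. The bound `B` may depend on `l`, so upper and lower coordinates can be estimated differently.
-/
theorem exists_int_combination_le {ι : Type*} [DecidableEq ι] {k : ℕ} (hk : 0 < k)
    (w : Fin k → ι → ℝ) (f : Fin k → ι) (hf : minor w f ≠ 0) :
    ∃ c : Fin k → ℤ, c ≠ 0 ∧ ∀ (l : ι) (B : ℝ),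
      (∀ a, |minor w (Function.update f a l)| ≤ B) →
      |∑ i, (c i : ℝ) * w i l| ≤ k * |minor w f| ^ (1 / (k : ℝ)) * (B / |minor w f|) := by
  obtain ⟨c, hc0, hc⟩ := exists_int_combination_norm_le hk (Matrix.of fun i j => w i (f j)) hf
  refine ⟨c, hc0, fun l B hB => ?_⟩
  have hD : 0 < |minor w f| := abs_pos.2 hf
  have h := congrArg abs (sum_mul_minor_update w f (fun i => (c i : ℝ)) l)
  rw [abs_mul] at h
  rw [mul_div_assoc', le_div_iff₀ hD, h]
  calc _ ≤ ∑ a, |(∑ i, (c i : ℝ) * w i (f a)) * minor w (Function.update f a l)| :=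
        Finset.abs_sum_le_sum_abs _ _
    _ ≤ ∑ a : Fin k, |minor w f| ^ (1 / (k : ℝ)) * B := by
        refine Finset.sum_le_sum fun a _ => ?_
        rw [abs_mul]
        exact mul_le_mul (hc a) (hB a) (abs_nonneg _) (by positivity)
    _ = _ := by simp; ring

/-- Replacing one index in Cramer's rule may destroy monotonicity or injectivity. The new minor is
then still, up to sign, a coordinate on some `e_J`, or it vanishes. -/
theorem minor_eq_zero_or_exists {N k : ℕ} (w : Fin k → Fin N → ℝ) (f : Fin k → Fin N) :
    minor w f = 0 ∨ ∃ J : Set.powersetCard (Fin N) k, Function.Injective f ∧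
      J.1 = Finset.univ.image f ∧
      |minor w f| = |minor w (Set.powersetCard.ofFinEmbEquiv.symm J)| := by
  by_cases hf : Function.Injective f
  · right
    have hcard : (Finset.univ.image f).card = k := by
      rw [Finset.card_image_of_injective _ hf]; simp
    refine ⟨⟨Finset.univ.image f, hcard⟩, hf, rfl, ?_⟩
    set g := Set.powersetCard.ofFinEmbEquiv.symm
      (⟨Finset.univ.image f, hcard⟩ : Set.powersetCard (Fin N) k) with hg
    have hmem : ∀ a, ∃ b, g b = f a := by
      intro a
      have := (Set.powersetCard.mem_range_ofFinEmbEquiv_symm_iff_mem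
        (⟨Finset.univ.image f, hcard⟩ : Set.powersetCard (Fin N) k) (f a)).2
        (by
          rw [← Set.powersetCard.mem_coe_iff]
          exact Finset.mem_image_of_mem f (Finset.mem_univ a))
      exact this
    choose σ hσ using hmem
    have hinj : Function.Injective σ := fun a b hab => hf (by rw [← hσ, ← hσ, hab])
    let τ : Equiv.Perm (Fin k) := Equiv.ofBijective σ (Finite.injective_iff_bijective.1 hinj)
    have : (Matrix.of fun i j => w i (f j)) =
        (Matrix.of fun i j => w i (g j)).submatrix id τ := by
      ext i j
      simp [τ, hσ]
    rw [minor, this, Matrix.det_permute', abs_mul]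
    rcases Int.units_eq_one_or (Equiv.Perm.sign τ) with h | h <;> simp [h, minor]
  · left
    rw [Function.not_injective_iff] at hf
    obtain ⟨a, b, hab, hne⟩ := hf
    exact Matrix.det_zero_of_column_eq hne (by simp [hab])

/-! ### Plücker coordinates and the projections `π_i` -/

theorem eBasis_repr_ιMulti {n k : ℕ} (w : Fin k → Fin (n + 1) → ℝ)
    (J : Set.powersetCard (Fin (n + 1)) k) :
    (eBasis n k).repr (exteriorPower.ιMulti ℝ k w) J =
      minor w (Set.powersetCard.ofFinEmbEquiv.symm J) := by
  rw [eBasis, exteriorPower.basis_repr_apply, exteriorPower.ιMultiDual_apply_ιMulti]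
  simp [minor]

theorem exists_minor_ne_zero {n k : ℕ} {w : Fin k → Fin (n + 1) → ℝ}
    (hw : LinearIndependent ℝ w) :
    ∃ J : Set.powersetCard (Fin (n + 1)) k,
      minor w (Set.powersetCard.ofFinEmbEquiv.symm J) ≠ 0 := by
  by_contra! h
  have h0 : exteriorPower.ιMulti ℝ k w = 0 := by
    apply (eBasis n k).repr.injective
    ext J
    simp [eBasis_repr_ιMulti, h]
  have hli := exteriorPower.ιMulti_family_linearIndependent_field k hw
  -- The member of the wedge family indexed by all of `Fin k` is the full wedge of `w`.
  have := hli.ne_zero (Set.powersetCard.ofFinEmbEquiv (RelEmbedding.refl (· ≤ ·)))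
  apply this
  rw [exteriorPower.ιMulti_family, Equiv.symm_apply_apply]
  exact h0

/-- The number of elements of `J` in `{0, …, d}`. -/
def topCount {N : ℕ} (d : ℕ) (J : Finset (Fin N)) : ℕ :=
  (J.filter fun j : Fin N => (j : ℕ) ≤ d).card

theorem eBasis_repr_proj {n k : ℕ} (d i : ℕ) (v : Lam n k)
    (J : Set.powersetCard (Fin (n + 1)) k) :
    (eBasis n k).repr (proj d i v) J =
      if topCount d J.1 = i then (eBasis n k).repr v J else 0 := by
  rw [proj, Basis.constr_apply_fintype]
  simp only [map_sum, map_smul, Finsupp.coe_finsetSum, Finset.sum_apply, Basis.equivFun_apply]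
  rw [Finset.sum_eq_single J]
  · unfold topCount
    split_ifs <;> simp
  · intro K _ hK
    split_ifs <;> simp [hK.symm]
  · simp

theorem abs_repr_le_supNorm {n k : ℕ} (v : Lam n k) (J : Set.powersetCard (Fin (n + 1)) k) :
    |(eBasis n k).repr v J| ≤ supNorm v :=
  le_ciSup (f := fun J => |(eBasis n k).repr v J|) (Set.finite_range _).bddAbove J

theorem supNorm_nonneg {n k : ℕ} (v : Lam n k) : 0 ≤ supNorm v :=
  Real.iSup_nonneg fun _ => abs_nonneg _

theorem abs_repr_le_supNorm_proj {n k d i : ℕ} (v : Lam n k)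
    {J : Set.powersetCard (Fin (n + 1)) k} (hJ : topCount d J.1 = i) :
    |(eBasis n k).repr v J| ≤ supNorm (proj d i v) := by
  have := abs_repr_le_supNorm (proj d i v) J
  rwa [eBasis_repr_proj, if_pos hJ] at this

theorem abs_repr_le_supNorm_projFix {n k d : ℕ} (v : Lam n k)
    {J : Set.powersetCard (Fin (n + 1)) k} (hJ : topCount d J.1 = 0 ∨ topCount d J.1 = d + 1) :
    |(eBasis n k).repr v J| ≤ supNorm (projFix d v) := by
  have := abs_repr_le_supNorm (projFix d v) J
  have e : (eBasis n k).repr (projFix d v) J =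
      (eBasis n k).repr (proj d 0 v) J + (eBasis n k).repr (proj d (d + 1) v) J := by
    simp [projFix]
  rw [e, eBasis_repr_proj, eBasis_repr_proj] at this
  rcases hJ with h | h <;> simpa [h] using this

/-! ### The actions of `u_A` and `b_t` in coordinates -/

theorem minor_smul {ι : Type*} {k : ℕ} (D : ι → ℝ) (w : Fin k → ι → ℝ) (f : Fin k → ι) :
    minor (fun i l => D l * w i l) f = (∏ a, D (f a)) * minor w f :=
  Matrix.det_mul_row (fun a => D (f a)) (Matrix.of fun i j => w i (f j))

theorem topCount_image {N k d : ℕ} {f : Fin k → Fin N} (hf : Function.Injective f) :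
    topCount d (Finset.univ.image f) = (Finset.univ.filter fun a => (f a : ℕ) ≤ d).card := by
  rw [topCount, Finset.filter_image, Finset.card_image_of_injective _ hf]

theorem blockEquiv_inl_le {d n : ℕ} (h : d < n) (i : Fin (d + 1)) :
    (blockEquiv h (Sum.inl i) : ℕ) ≤ d := by
  simp [blockEquiv]; omega

theorem lt_blockEquiv_inr {d n : ℕ} (h : d < n) (j : Fin (n - d)) :
    d < (blockEquiv h (Sum.inr j) : ℕ) := by
  simp [blockEquiv]; omega

theorem reindex_mulVec_blockEquiv {d n : ℕ} (h : d < n)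
    (M : Matrix (Fin (d + 1) ⊕ Fin (n - d)) (Fin (d + 1) ⊕ Fin (n - d)) ℝ)
    (x : Fin (n + 1) → ℝ) (s : Fin (d + 1) ⊕ Fin (n - d)) :
    (Matrix.reindex (blockEquiv h) (blockEquiv h) M).mulVec x (blockEquiv h s) =
      M.mulVec (fun u => x (blockEquiv h u)) s := by
  rw [Matrix.reindex_apply, Matrix.submatrix_mulVec_equiv]
  simp [Function.comp_def]

theorem uA_mulVec_inl {d n : ℕ} (h : d < n) (A : Matrix (Fin (d + 1)) (Fin (n - d)) ℝ)
    (x : Fin (n + 1) → ℝ) (i : Fin (d + 1)) :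
    (uA h A).1.mulVec x (blockEquiv h (Sum.inl i)) =
      x (blockEquiv h (Sum.inl i)) + A.mulVec (fun j => x (blockEquiv h (Sum.inr j))) i := by
  rw [uA, reindex_mulVec_blockEquiv, Matrix.fromBlocks_mulVec]
  simp [Function.comp_def]

theorem uA_mulVec_inr {d n : ℕ} (h : d < n) (A : Matrix (Fin (d + 1)) (Fin (n - d)) ℝ)
    (x : Fin (n + 1) → ℝ) (j : Fin (n - d)) :
    (uA h A).1.mulVec x (blockEquiv h (Sum.inr j)) = x (blockEquiv h (Sum.inr j)) := by
  rw [uA, reindex_mulVec_blockEquiv, Matrix.fromBlocks_mulVec]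
  simp [Function.comp_def]

/-- The diagonal entries of `b_t`. -/
def dil (d n : ℕ) (t : ℝ) (l : Fin (n + 1)) : ℝ :=
  Real.exp (((if (l : ℕ) ≤ d then 1 / ((d : ℝ) + 1) else 0) - 1 / ((n : ℝ) + 1)) * t)

theorem dil_pos {d n : ℕ} (t : ℝ) (l : Fin (n + 1)) : 0 < dil d n t l := Real.exp_pos _

theorem bt_mulVec {d n : ℕ} (h : d < n) (t : ℝ) (x : Fin (n + 1) → ℝ) (l : Fin (n + 1)) :
    (bt h t).1.mulVec x l = dil d n t l * x l := by
  obtain ⟨s, rfl⟩ := (blockEquiv h).surjective l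
  rw [bt, reindex_mulVec_blockEquiv, Matrix.fromBlocks_mulVec]
  rcases s with i | j
  · have := blockEquiv_inl_le h i
    simp only [dil, if_pos this]
    simp [Function.comp_def, Matrix.smul_mulVec]
    left
    field_simp
    ring_nf
    simp
  · have := lt_blockEquiv_inr h j
    simp only [dil, if_neg (not_le.2 this)]
    simp [Function.comp_def, Matrix.smul_mulVec]

theorem prod_dil {d n k : ℕ} (t : ℝ) (J : Set.powersetCard (Fin (n + 1)) k) :
    ∏ a, dil d n t (Set.powersetCard.ofFinEmbEquiv.symm J a) =
      Real.exp (((topCount d J.1 : ℝ) / ((d : ℝ) + 1) - k / ((n : ℝ) + 1)) * t) := by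
  have himg : Finset.univ.image (Set.powersetCard.ofFinEmbEquiv.symm J) = J.1 := by
    ext x
    have := Set.powersetCard.mem_range_ofFinEmbEquiv_symm_iff_mem J x
    rw [← Set.powersetCard.mem_coe_iff] at this
    rw [← this]; simp
  have hc := topCount_image (d := d) (Set.powersetCard.ofFinEmbEquiv.symm J).injective
  rw [himg] at hc
  simp only [dil]
  rw [← Real.exp_sum, ← Finset.sum_mul, Finset.sum_sub_distrib, Finset.sum_ite, hc]
  congr 1
  simp
  ring_nf
  simp

theorem minor_dil {d n k : ℕ} (t : ℝ) (w : Fin k → Fin (n + 1) → ℝ)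
    (J : Set.powersetCard (Fin (n + 1)) k) :
    minor (fun i l => dil d n t l * w i l) (Set.powersetCard.ofFinEmbEquiv.symm J) =
      Real.exp (((topCount d J.1 : ℝ) / ((d : ℝ) + 1) - k / ((n : ℝ) + 1)) * t) *
        minor w (Set.powersetCard.ofFinEmbEquiv.symm J) := by
  rw [minor_smul, prod_dil]

/-! ### The Diophantine lower bound on lattice vectors -/

theorem mem_latticeOf_mul {n : ℕ} (g g' : G n) (x : Fin (n + 1) → ℝ)
    (hx : x ∈ latticeOf (g * g')) : ∃ y ∈ latticeOf g', x = g.1.mulVec y := by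
  obtain ⟨z, rfl⟩ := hx
  exact ⟨_, ⟨z, rfl⟩, by simp [Matrix.mulVec_mulVec]⟩

theorem sum_int_mul_mem_latticeOf {n k : ℕ} (g : G n) {w : Fin k → Fin (n + 1) → ℝ}
    (hw : ∀ i, w i ∈ latticeOf g) (c : Fin k → ℤ) :
    (fun l => ∑ i, (c i : ℝ) * w i l) ∈ latticeOf g := by
  choose z hz using hw
  refine ⟨fun l => ∑ i, c i * z i l, ?_⟩
  have : (fun l => ∑ i, (c i : ℝ) * w i l) = ∑ i, (c i : ℝ) • w i := by
    ext l; simp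
  rw [this]
  simp only [← hz, ← Matrix.mulVec_smul, ← Matrix.mulVec_sum]
  congr 1
  ext l
  simp

theorem sum_int_mul_ne_zero {N k : ℕ} {w : Fin k → Fin N → ℝ} (hw : LinearIndependent ℝ w)
    {c : Fin k → ℤ} (hc : c ≠ 0) : (fun l => ∑ i, (c i : ℝ) * w i l) ≠ 0 := by
  intro h
  apply hc
  have : ∑ i, (c i : ℝ) • w i = 0 := by
    ext l; simpa using congrFun h l
  ext i
  simpa using Fintype.linearIndependent_iff.1 hw _ this i

theorem exists_pos_le_of_finite {α : Type*} {S : Set α} (hS : S.Finite) (f : α → ℝ)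
    (hf : ∀ x ∈ S, 0 < f x) : ∃ c : ℝ, 0 < c ∧ c ≤ 1 ∧ ∀ x ∈ S, c ≤ f x := by
  rcases S.eq_empty_or_nonempty with rfl | hne
  · exact ⟨1, one_pos, le_rfl, by simp⟩
  · obtain ⟨a, ha, hmin⟩ := Set.exists_min_image S f hS hne
    exact ⟨min 1 (f a), lt_min one_pos (hf a ha), min_le_left _ _,
      fun x hx => (min_le_right _ _).trans (hmin x hx)⟩

/-- Above the exponent only finitely many approximations beat `‖q‖^{-w}`. None of them is exact, so
shrinking the constant absorbs them all. -/
theorem exists_pos_le_norm_mulVec_sub {r s : ℕ} {A : Matrix (Fin r) (Fin s) ℝ} {w : ℝ}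
    (hw : diophExp A < (w : EReal)) :
    ∃ c : ℝ, 0 < c ∧ c ≤ 1 ∧ ∀ (q : Fin s → ℤ) (p : Fin r → ℤ), q ≠ 0 →
      c * ‖(fun j => (q j : ℝ))‖ ^ (-w) ≤
        ‖A.mulVec (fun j => (q j : ℝ)) - (fun i => (p i : ℝ))‖ := by
  let S := {x : (Fin s → ℤ) × (Fin r → ℤ) | x.1 ≠ 0 ∧
      ‖A.mulVec (fun j => (x.1 j : ℝ)) - (fun i => (x.2 i : ℝ))‖
        ≤ ‖(fun j => (x.1 j : ℝ))‖ ^ (-w)}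
  have hS : S.Finite := by
    by_contra hinf
    exact absurd (le_sSup (Set.mem_image_of_mem _ hinf)) (not_le.2 hw)
  have hqpos : ∀ q : Fin s → ℤ, q ≠ 0 → 0 < ‖(fun j => (q j : ℝ))‖ := by
    intro q hq
    rw [norm_pos_iff]
    intro h0
    apply hq
    ext j
    simpa using congrFun h0 j
  have hpos : ∀ x : (Fin s → ℤ) × (Fin r → ℤ), x.1 ≠ 0 →
      0 < ‖A.mulVec (fun j => (x.1 j : ℝ)) - (fun i => (x.2 i : ℝ))‖ := by
    intro x hx
    rw [norm_pos_iff]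
    intro h0
    -- An exact solution would have infinitely many positive integer multiples, all exact.
    refine Set.infinite_of_injective_forall_mem (α := ℕ)
      (f := fun m => (((m : ℤ) + 1) • x.1, ((m : ℤ) + 1) • x.2)) ?_ ?_ hS
    · intro m m' hmm
      have := congrArg Prod.fst hmm
      have := smul_left_injective ℤ hx this
      simpa using this
    · intro m
      refine ⟨smul_ne_zero (by positivity) hx, ?_⟩
      have h1 : (fun j => ((((m : ℤ) + 1) • x.1) j : ℝ)) =
          ((m : ℝ) + 1) • fun j => (x.1 j : ℝ) := by ext j; simp
      have h2 : (fun j => ((((m : ℤ) + 1) • x.2) j : ℝ)) =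
          ((m : ℝ) + 1) • fun j => (x.2 j : ℝ) := by ext j; simp
      simp only [h1, h2, Matrix.mulVec_smul, ← smul_sub, h0, smul_zero, norm_zero]
      positivity
  obtain ⟨c, hc0, hc1, hc⟩ := exists_pos_le_of_finite hS
    (fun x => ‖A.mulVec (fun j => (x.1 j : ℝ)) - (fun i => (x.2 i : ℝ))‖ /
      ‖(fun j => (x.1 j : ℝ))‖ ^ (-w))
    (fun x hx => by
      have hx1 : x.1 ≠ 0 := hx.1
      have h1 := hpos x hx1
      have h2 := Real.rpow_pos_of_pos (hqpos x.1 hx1) (-w)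
      exact div_pos h1 h2)
  refine ⟨c, hc0, hc1, fun q p hq => ?_⟩
  have hq' : 0 < ‖(fun j => (q j : ℝ))‖ ^ (-w) := Real.rpow_pos_of_pos (hqpos q hq) _
  by_cases hx : (q, p) ∈ S
  · have h1 := hc (q, p) hx
    rw [le_div_iff₀ hq'] at h1
    exact h1
  · have : ‖(fun j => (q j : ℝ))‖ ^ (-w) <
        ‖A.mulVec (fun j => (q j : ℝ)) - (fun i => (p i : ℝ))‖ := by
      by_contra hle
      exact hx ⟨hq, not_lt.1 hle⟩
    nlinarith

/-- Vectors of the lattice `u_A ℤ^{n+1}` obey the Diophantine lower bound. -/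
theorem exists_pos_le_of_mem_latticeOf {d n : ℕ} (h : d < n)
    {A : Matrix (Fin (d + 1)) (Fin (n - d)) ℝ} {w : ℝ} (hw0 : 0 ≤ w)
    (hw : diophExp A < (w : EReal)) :
    ∃ c : ℝ, 0 < c ∧ ∀ y ∈ latticeOf (uA h A), y ≠ 0 → ∀ Q X : ℝ, 1 ≤ Q →
      (∀ l : Fin (n + 1), d < (l : ℕ) → |y l| ≤ Q) →
      (∀ l : Fin (n + 1), (l : ℕ) ≤ d → |y l| ≤ X) → c * Q ^ (-w) ≤ X := by
  obtain ⟨c, hc0, hc1, hc⟩ := exists_pos_le_norm_mulVec_sub hw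
  refine ⟨c, hc0, ?_⟩
  rintro _ ⟨z, rfl⟩ hy Q X hQ1 hQ hX
  dsimp only at hy hQ hX
  have hX0 : 0 ≤ X := (abs_nonneg _).trans (hX _ (blockEquiv_inl_le h 0))
  have hQX : ∀ i, |(z (blockEquiv h (Sum.inl i)) : ℝ) +
      A.mulVec (fun j => (z (blockEquiv h (Sum.inr j)) : ℝ)) i| ≤ X := by
    intro i
    have := hX _ (blockEquiv_inl_le h i)
    rwa [uA_mulVec_inl] at this
  -- A vector with `q = 0` has a nonzero integer among its upper coordinates, so `X ≥ 1`. Here `Q ≥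
  -- 1` and `c ≤ 1` are needed.
  by_cases hq : (fun j => z (blockEquiv h (Sum.inr j))) = 0
  · have hq' : ∀ j, z (blockEquiv h (Sum.inr j)) = 0 := congrFun hq
    have hz : ∃ i, z (blockEquiv h (Sum.inl i)) ≠ 0 := by
      by_contra! hall
      apply hy
      have : z = 0 := by
        ext l
        obtain ⟨s, rfl⟩ := (blockEquiv h).surjective l
        rcases s with i | j
        · exact hall i
        · exact hq' j
      ext l
      simp [this, Matrix.mulVec, dotProduct]
    obtain ⟨i, hi⟩ := hz
    have h1 := hQX i
    have h2 : A.mulVec (fun j => (z (blockEquiv h (Sum.inr j)) : ℝ)) i = 0 := by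
      simp [hq', Matrix.mulVec, dotProduct]
    rw [h2, add_zero] at h1
    have h3 : (1 : ℝ) ≤ |(z (blockEquiv h (Sum.inl i)) : ℝ)| := by
      exact_mod_cast Int.one_le_abs hi
    have h4 : Q ^ (-w) ≤ 1 := Real.rpow_le_one_of_one_le_of_nonpos hQ1 (by linarith)
    have h5 : 0 ≤ Q ^ (-w) := by positivity
    nlinarith
  · have hle := hc (fun j => z (blockEquiv h (Sum.inr j)))
      (fun i => -z (blockEquiv h (Sum.inl i))) hq
    have hqn : 0 < ‖(fun j => (z (blockEquiv h (Sum.inr j)) : ℝ))‖ := by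
      rw [norm_pos_iff]
      intro h0
      apply hq
      ext j
      simpa using congrFun h0 j
    have hqQ : ‖(fun j => (z (blockEquiv h (Sum.inr j)) : ℝ))‖ ≤ Q := by
      rw [pi_norm_le_iff_of_nonneg (by linarith)]
      intro j
      have := hQ _ (lt_blockEquiv_inr h j)
      rwa [uA_mulVec_inr] at this
    calc c * Q ^ (-w) ≤ c * ‖(fun j => (z (blockEquiv h (Sum.inr j)) : ℝ))‖ ^ (-w) :=
          mul_le_mul_of_nonneg_left
            (Real.rpow_le_rpow_of_nonpos hqn hqQ (by linarith)) hc0.le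
      _ ≤ _ := hle
      _ ≤ X := by
          rw [pi_norm_le_iff_of_nonneg hX0]
          intro i
          have := hQX i
          simpa [add_comm] using this

/-! ### Dirichlet's lower bound for the exponent -/

theorem eventually_const_lt_exp_mul (C : ℝ) {x : ℝ} (hx : 0 < x) :
    ∀ᶠ t : ℝ in atTop, C < Real.exp (x * t) :=
  (Real.tendsto_exp_atTop.comp (tendsto_id.const_mul_atTop hx)).eventually_gt_atTop C

/-- Dirichlet's theorem. -/
theorem le_diophExp {d n : ℕ} (h : d < n) (A : Matrix (Fin (d + 1)) (Fin (n - d)) ℝ) :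
    ((((n : ℝ) - d) / ((d : ℝ) + 1) : ℝ) : EReal) ≤ diophExp A := by
  by_contra! hlt
  have hdn : (d : ℝ) < n := by exact_mod_cast h
  have hpos : (0 : ℝ) < ((n : ℝ) - d) / ((d : ℝ) + 1) := by
    have : 0 < (n : ℝ) - d := by linarith
    positivity
  -- The maximum with `0` makes `w` a positive real, even if the exponent were a priori negative or
  -- `-∞`.
  obtain ⟨w, hw1, hw2⟩ := EReal.lt_iff_exists_real_btwn.1
    (max_lt hlt (EReal.coe_lt_coe_iff.2 hpos))
  have hw0 : 0 < w := EReal.coe_lt_coe_iff.1 ((le_max_right _ _).trans_lt hw1)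
  replace hw2 := EReal.coe_lt_coe_iff.1 hw2
  obtain ⟨c, hc0, hc⟩ := exists_pos_le_of_mem_latticeOf h hw0.le ((le_max_left _ _).trans_lt hw1)
  have hx : 0 < (1 / ((d : ℝ) + 1) - 1 / ((n : ℝ) + 1)) - 1 / ((n : ℝ) + 1) * w := by
    have : 1 / ((d : ℝ) + 1) - 1 / ((n : ℝ) + 1) =
      1 / ((n : ℝ) + 1) * (((n : ℝ) - d) / ((d : ℝ) + 1)) := by field_simp; ring
    rw [this, ← mul_sub]
    have : 0 < ((n : ℝ) - d) / ((d : ℝ) + 1) - w := by linarith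
    positivity
  obtain ⟨t, ht0, ht⟩ :=
    ((eventually_ge_atTop (0 : ℝ)).and (eventually_const_lt_exp_mul c⁻¹ hx)).exists
  set g : G n := bt h t * uA h A with hg
  -- The lattice of `b_t u_A` has covolume one, so it contains a nonzero vector of norm at most one.
  -- Undoing `b_t` contradicts the lower bound for large `t`.
  obtain ⟨z, hz0, hz⟩ := exists_int_combination_norm_le (Nat.succ_pos n) g.1.transpose
    (by rw [Matrix.det_transpose, g.2]; exact one_ne_zero)
  rw [Matrix.det_transpose, g.2, abs_one, Real.one_rpow] at hz
  set y := (uA h A).1.mulVec (fun i => (z i : ℝ)) with hy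
  have hgy : ∀ l, |y l| ≤ (dil d n t l)⁻¹ := by
    intro l
    have h1 : ∑ i, (z i : ℝ) * g.1.transpose i l = dil d n t l * y l := by
      rw [← bt_mulVec h, hy, Matrix.mulVec_mulVec]
      simp [Matrix.mulVec, dotProduct, hg, mul_comm]
    have h2 := hz l
    rw [h1, abs_mul, abs_of_pos (dil_pos t l)] at h2
    rw [← one_div, le_div_iff₀' (dil_pos t l)]
    exact h2
  have hy0 : y ≠ 0 := by
    intro h0
    apply hz0
    have h1 := Matrix.eq_zero_of_mulVec_eq_zero
      (by rw [(uA h A).2]; exact one_ne_zero) (hy.symm.trans h0)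
    ext i
    simpa using congrFun h1 i
  have key := hc y ⟨z, rfl⟩ hy0 (Real.exp (1 / ((n : ℝ) + 1) * t))
    (Real.exp (-(1 / ((d : ℝ) + 1) - 1 / ((n : ℝ) + 1)) * t))
    (Real.one_le_exp (by positivity))
    (by
      intro l hl
      refine (hgy l).trans_eq ?_
      rw [dil, if_neg (not_le.2 hl), ← Real.exp_neg]
      ring_nf)
    (by
      intro l hl
      refine (hgy l).trans_eq ?_
      rw [dil, if_pos hl, ← Real.exp_neg]
      ring_nf)
  rw [← Real.exp_mul] at key
  have h3 : c * Real.exp ((1 / ((d : ℝ) + 1) - 1 / ((n : ℝ) + 1) - 1 / ((n : ℝ) + 1) * w) * t)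
      ≤ 1 := by
    have := mul_le_mul_of_nonneg_right key
      (Real.exp_pos ((1 / ((d : ℝ) + 1) - 1 / ((n : ℝ) + 1)) * t)).le
    rw [mul_assoc, ← Real.exp_add, ← Real.exp_add] at this
    have e1 : 1 / ((n : ℝ) + 1) * t * -w + (1 / ((d : ℝ) + 1) - 1 / ((n : ℝ) + 1)) * t =
      (1 / ((d : ℝ) + 1) - 1 / ((n : ℝ) + 1) - 1 / ((n : ℝ) + 1) * w) * t := by ring
    have e2 : -(1 / ((d : ℝ) + 1) - 1 / ((n : ℝ) + 1)) * t +
      (1 / ((d : ℝ) + 1) - 1 / ((n : ℝ) + 1)) * t = 0 := by ring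
    rwa [e1, e2, Real.exp_zero] at this
  rw [inv_lt_iff_one_lt_mul₀' hc0] at ht
  linarith

/-! ### From large height to small coordinates -/

theorem topCount_le {N : ℕ} (d : ℕ) (J : Finset (Fin N)) : topCount d J ≤ d + 1 := by
  rw [← Finset.card_range (d + 1)]
  refine Finset.card_le_card_of_injOn (fun j : Fin N => (j : ℕ)) ?_ ?_
  · intro j hj
    simp at hj ⊢
    omega
  · intro i _ j _ hij
    exact Fin.ext hij

theorem le_mul_rpow_of_lt_ofReal_mul {e X M r δ : ℝ} (he : 0 < e) (hX : 0 ≤ X) (hM : 0 < M)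
    (hr : 0 < r)
    (h : ENNReal.ofReal M < ENNReal.ofReal (e ^ (r * δ)) * ENNReal.ofReal X ^ (-r)) :
    X ≤ e ^ δ * M ^ (-(1 / r)) := by
  rcases hX.eq_or_lt with rfl | hX
  · positivity
  rw [ENNReal.ofReal_rpow_of_pos hX, ← ENNReal.ofReal_mul (by positivity),
    ENNReal.ofReal_lt_ofReal_iff (by positivity), Real.rpow_neg hX.le, ← div_eq_mul_inv,
    lt_div_iff₀ (by positivity), ← lt_div_iff₀' hM] at h
  have h2 := Real.rpow_le_rpow (by positivity) h.le (one_div_nonneg.2 hr.le)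
  rw [← Real.rpow_mul hX.le, mul_one_div_cancel hr.ne', Real.rpow_one,
    Real.div_rpow (by positivity) hM.le, ← Real.rpow_mul he.le] at h2
  rw [Real.rpow_neg hM.le, ← div_eq_mul_inv]
  convert h2 using 3
  field_simp

theorem supNorm_le_of_lt_phi {n k d : ℕ} {ε M : ℝ} (hε : 0 < ε) (hM : 0 < M) {v : Lam n k}
    (h : ENNReal.ofReal M < phi d ε v) :
    supNorm (projFix d v) < ε ^ del n k ∧ ∀ i, 1 ≤ i → i ≤ d →
      supNorm (proj d i v) ≤ ε ^ del n k * M ^ (-(((d : ℝ) + 1 - i) / ((d : ℝ) + 1))) := by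
  rw [phi] at h
  split_ifs at h with hfix
  · refine ⟨hfix, fun i hi hid => ?_⟩
    have hlt := h.trans_le (iInf₂_le i (Finset.mem_Icc.2 ⟨hi, hid⟩))
    have hid' : (i : ℝ) ≤ d := by exact_mod_cast hid
    have hpos : 0 < (d : ℝ) + 1 - i := by linarith
    have := le_mul_rpow_of_lt_ofReal_mul hε (supNorm_nonneg _) hM
      (div_pos (by positivity) hpos) hlt
    rwa [one_div_div] at this
  · simp at h

/-- A lower bound for `φ_ε(v)` bounds every coordinate of `v`. -/
theorem abs_repr_le_of_lt_phi {n k d : ℕ} {ε R t : ℝ} (hε : 0 < ε) {v : Lam n k}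
    (h : ENNReal.ofReal (Real.exp (R * t)) < phi d ε v) (J : Set.powersetCard (Fin (n + 1)) k) :
    |(eBasis n k).repr v J| ≤ max 1 (ε ^ del n k) *
      Real.exp ((if topCount d J.1 = 0 then 0
        else -(R * (1 - (topCount d J.1 : ℝ) / ((d : ℝ) + 1)))) * t) := by
  obtain ⟨hfix, hi⟩ := supNorm_le_of_lt_phi hε (Real.exp_pos _) h
  have hE : ε ^ del n k ≤ max 1 (ε ^ del n k) := le_max_right _ _
  split_ifs with h0
  · simpa using (abs_repr_le_supNorm_projFix v (.inl h0)).trans (hfix.le.trans hE)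
  · rcases (topCount_le d J.1).lt_or_eq with hlt | heq
    · refine (abs_repr_le_supNorm_proj v rfl).trans
        ((hi _ (Nat.one_le_iff_ne_zero.2 h0) (Nat.lt_succ_iff.1 hlt)).trans ?_)
      rw [← Real.exp_mul]
      refine (mul_le_mul_of_nonneg_right hE (Real.exp_pos _).le).trans_eq ?_
      congr 2
      field_simp
    -- At `i = d+1` the decay rate is zero, so the bound on `π_fix` fits the general formula. Only
    -- `i = 0` is exceptional.
    · have h1 : (1 : ℝ) - (topCount d J.1 : ℝ) / ((d : ℝ) + 1) = 0 := by
        rw [heq]; push_cast; field_simp; ring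
      rw [h1]
      simpa using (abs_repr_le_supNorm_projFix v (.inr heq)).trans (hfix.le.trans hE)

/-! ### Excluding uniformly small coordinates -/

theorem exp_le_of_rpow_neg_le {c C g h w t : ℝ} (hc : 0 < c) (hC : 0 < C)
    (hle : c * (C * Real.exp (g * t)) ^ (-w) ≤ C * Real.exp (-h * t)) :
    Real.exp ((h - g * w) * t) ≤ C * C ^ w / c := by
  rw [Real.mul_rpow hC.le (Real.exp_pos _).le, ← Real.exp_mul, Real.rpow_neg hC.le] at hle
  have hCw : 0 < C ^ w := Real.rpow_pos_of_pos hC w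
  rw [le_div_iff₀ hc]
  have h1 : Real.exp ((h - g * w) * t) = Real.exp (g * t * -w) * Real.exp (h * t) := by
    rw [← Real.exp_add]; ring_nf
  have h2 : Real.exp (-h * t) * Real.exp (h * t) = 1 := by
    rw [← Real.exp_add]; simp
  have h3 := mul_le_mul_of_nonneg_right hle (mul_pos hCw (Real.exp_pos (h * t))).le
  calc Real.exp ((h - g * w) * t) * c
      = c * ((C ^ w)⁻¹ * Real.exp (g * t * -w)) * (C ^ w * Real.exp (h * t)) := by
        rw [h1]; field_simp
    _ ≤ _ := h3
    _ = C * C ^ w * (Real.exp (-h * t) * Real.exp (h * t)) := by ring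
    _ = C * C ^ w := by rw [h2, mul_one]

/-- This exponent measures how far Minkowski's vector at time `(1-R)t` violates the Diophantine
bound. It vanishes exactly at the threshold `R = ns/((1+s)(n+1))`. -/
theorem rate_pos_of_small_covolume {d n w R : ℝ} (hd : 0 < d + 1) (hn : 0 < n)
    (h1 : n * ((d + 1) * w - (n - d)) < R * (1 + ((d + 1) * w - (n - d))) * (n + 1)) :
    0 < ((1 / (d + 1) - 1 / (n + 1)) * (1 - R) + R / (n * (n + 1))) -
      ((1 - R) / (n + 1) - R / (n * (n + 1))) * w := by
  have : ((1 / (d + 1) - 1 / (n + 1)) * (1 - R) + R / (n * (n + 1))) -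
      ((1 - R) / (n + 1) - R / (n * (n + 1))) * w =
      (R * (1 + ((d + 1) * w - (n - d))) * (n + 1) - n * ((d + 1) * w - (n - d))) /
        (n * (n + 1) * (d + 1)) := by
    field_simp
    ring
  rw [this]
  exact div_pos (by linarith) (by positivity)

theorem exists_minor_maximal {n k : ℕ} (w : Fin k → Fin (n + 1) → ℝ)
    (p : Set.powersetCard (Fin (n + 1)) k → Prop) (J₀ : Set.powersetCard (Fin (n + 1)) k)
    (hJ₀ : p J₀) (hne : minor w (Set.powersetCard.ofFinEmbEquiv.symm J₀) ≠ 0) :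
    ∃ J, p J ∧ minor w (Set.powersetCard.ofFinEmbEquiv.symm J) ≠ 0 ∧
      |minor w (Set.powersetCard.ofFinEmbEquiv.symm J₀)| ≤
        |minor w (Set.powersetCard.ofFinEmbEquiv.symm J)| ∧
      ∀ K, p K → |minor w (Set.powersetCard.ofFinEmbEquiv.symm K)| ≤
        |minor w (Set.powersetCard.ofFinEmbEquiv.symm J)| := by
  obtain ⟨J, hJ, hmax⟩ := Set.exists_max_image {J | p J}
    (fun J => |minor w (Set.powersetCard.ofFinEmbEquiv.symm J)|) (Set.toFinite _) ⟨J₀, hJ₀⟩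
  refine ⟨J, hJ, ?_, hmax _ hJ₀, hmax⟩
  exact abs_pos.1 ((abs_pos.2 hne).trans_le (hmax _ hJ₀))

/-- If all coordinates of `b_{(1-R)t} (w_1 ∧ ⋯ ∧ w_k)` are small, then Minkowski's theorem
contradicts the Diophantine lower bound. -/
theorem eventually_exists_lt_minor {d n k : ℕ} (h : d < n)
    {A : Matrix (Fin (d + 1)) (Fin (n - d)) ℝ} (hk : 1 ≤ k) (hkn : k ≤ n) {w R E : ℝ}
    (hw0 : 0 ≤ w) (hw : diophExp A < (w : EReal)) (hE : 1 ≤ E) (hR : 0 ≤ R)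
    (hRn : R * ((n : ℝ) + 1) ≤ n)
    (h1 : (n : ℝ) * (((d : ℝ) + 1) * w - (n - d)) <
      R * (1 + (((d : ℝ) + 1) * w - (n - d))) * ((n : ℝ) + 1)) :
    ∀ᶠ t : ℝ in atTop, ∀ x : Fin k → Fin (n + 1) → ℝ, (∀ i, x i ∈ latticeOf (uA h A)) →
      LinearIndependent ℝ x → ∃ J : Set.powersetCard (Fin (n + 1)) k,
        E * Real.exp ((k / ((n : ℝ) + 1) - R -
          (topCount d J.1 : ℝ) * (1 - R) / ((d : ℝ) + 1)) * t) <
        |minor x (Set.powersetCard.ofFinEmbEquiv.symm J)| := by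
  obtain ⟨c, hc0, hc⟩ := exists_pos_le_of_mem_latticeOf h hw0 hw
  have hk1 : (1 : ℝ) ≤ k := by exact_mod_cast hk
  have hkn' : (k : ℝ) ≤ n := by exact_mod_cast hkn
  have hn0 : (0 : ℝ) < n := by linarith
  have hx := rate_pos_of_small_covolume (d := d) (n := n) (by positivity) hn0 h1
  filter_upwards [eventually_ge_atTop 0,
    eventually_const_lt_exp_mul (k * E * (k * E) ^ w / c) hx] with t ht0 ht x hxL hli
  by_contra! hall
  -- At this time the dependence on the number `i` of upper indices cancels: every coordinate is at
  -- most `E e^{-R(1-k/(n+1))t}`.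
  set T := (1 - R) * t with hT
  set y : Fin k → Fin (n + 1) → ℝ := fun i l => dil d n T l * x i l with hy
  obtain ⟨J₀, hJ₀⟩ := exists_minor_ne_zero hli
  have hJ₀' : minor y (Set.powersetCard.ofFinEmbEquiv.symm J₀) ≠ 0 := by
    rw [hy, minor_dil]
    exact mul_ne_zero (Real.exp_pos _).ne' hJ₀
  obtain ⟨J, -, hJ0, -, hmax⟩ := exists_minor_maximal y (fun _ => True) J₀ trivial hJ₀'
  have hD : 0 < |minor y (Set.powersetCard.ofFinEmbEquiv.symm J)| := abs_pos.2 hJ0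
  set D := |minor y (Set.powersetCard.ofFinEmbEquiv.symm J)| with hDdef
  have hDle : D ≤ E * Real.exp (-(R * (1 - k / ((n : ℝ) + 1))) * t) := by
    rw [hDdef, hy, minor_dil, abs_mul, abs_of_pos (Real.exp_pos _)]
    refine (mul_le_mul_of_nonneg_left (hall J) (Real.exp_pos _).le).trans_eq ?_
    rw [mul_left_comm, ← Real.exp_add]
    congr 2
    rw [hT]
    ring
  have hDk : D ^ (1 / (k : ℝ)) ≤ E * Real.exp (-(R / (n * ((n : ℝ) + 1))) * t) := by
    refine (Real.rpow_le_rpow hD.le hDle (by positivity)).trans ?_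
    rw [Real.mul_rpow (by positivity) (Real.exp_pos _).le, ← Real.exp_mul]
    refine mul_le_mul ?_ ?_ (Real.exp_pos _).le (by positivity)
    · exact (Real.rpow_le_rpow_of_exponent_le hE ((div_le_one (by positivity)).2 hk1)).trans_eq
        (Real.rpow_one E)
    · rw [Real.exp_le_exp]
      -- The weakest decay of the `k`-th root of the covolume occurs at `k = n`.
      have : R / (n * ((n : ℝ) + 1)) ≤ R * (1 - k / ((n : ℝ) + 1)) * (1 / k) := by
        rw [div_le_iff₀ (by positivity)]
        have e : R * (1 - k / ((n : ℝ) + 1)) * (1 / k) * (n * ((n : ℝ) + 1)) =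
          R * (n * (n + 1 - k) / k) := by field_simp
        rw [e]
        have : 1 ≤ (n : ℝ) * (n + 1 - k) / k := by
          rw [le_div_iff₀ (by positivity)]
          nlinarith
        nlinarith
      nlinarith
  obtain ⟨m, hm0, hm⟩ := exists_int_combination_le hk y _ hJ0
  have hB : ∀ l, |dil d n T l * ∑ i, (m i : ℝ) * x i l| ≤
      k * E * Real.exp (-(R / (n * ((n : ℝ) + 1))) * t) := by
    intro l
    have h2 := hm l D (fun a => by
      rcases minor_eq_zero_or_exists y (Function.update _ a l) with h0 | ⟨K, -, -, hK⟩
      · rw [h0, abs_zero]; exact hD.le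
      · rw [hK]; exact hmax K trivial)
    rw [div_self hD.ne', mul_one] at h2
    rw [Finset.mul_sum]
    refine le_trans (le_of_eq ?_) (h2.trans ?_)
    · congr 1
      exact Finset.sum_congr rfl fun i _ => by rw [hy]; ring
    · rw [mul_assoc]
      exact mul_le_mul_of_nonneg_left hDk (by positivity)
  have hB' : ∀ l, |∑ i, (m i : ℝ) * x i l| ≤
      k * E * (Real.exp (-(R / (n * ((n : ℝ) + 1))) * t) * (dil d n T l)⁻¹) := by
    intro l
    have h2 := hB l
    rw [abs_mul, abs_of_pos (dil_pos _ _), ← le_div_iff₀' (dil_pos _ _)] at h2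
    rwa [← mul_assoc, ← div_eq_mul_inv]
  have hkE : 1 ≤ (k : ℝ) * E := by nlinarith
  have key := hc _ (sum_int_mul_mem_latticeOf _ hxL m) (sum_int_mul_ne_zero hli hm0)
    (k * E * Real.exp (((1 - R) / ((n : ℝ) + 1) - R / (n * ((n : ℝ) + 1))) * t))
    (k * E * Real.exp (-((1 / ((d : ℝ) + 1) - 1 / ((n : ℝ) + 1)) * (1 - R) +
      R / (n * ((n : ℝ) + 1))) * t))
    (by
      -- The condition `R ≤ n/(n+1)` keeps the box size `Q` at least one.
      have : 0 ≤ ((1 - R) / ((n : ℝ) + 1) - R / (n * ((n : ℝ) + 1))) := by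
        have e : ((1 - R) / ((n : ℝ) + 1) - R / (n * ((n : ℝ) + 1))) =
          (n - R * ((n : ℝ) + 1)) / (n * ((n : ℝ) + 1)) := by field_simp; ring
        rw [e]
        exact div_nonneg (by linarith) (by positivity)
      have := Real.one_le_exp (mul_nonneg this ht0)
      nlinarith)
    (by
      intro l hl
      refine (hB' l).trans_eq ?_
      rw [dil, if_neg (not_le.2 hl), ← Real.exp_neg, ← Real.exp_add, hT]
      ring_nf)
    (by
      intro l hl
      refine (hB' l).trans_eq ?_
      rw [dil, if_pos hl, ← Real.exp_neg, ← Real.exp_add, hT]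
      ring_nf)
  exact absurd (exp_le_of_rpow_neg_le hc0 (by linarith) key) (not_le.2 ht)

/-! ### The lower bound for `π_1` in terms of `π_0` -/

/-- The lower block of `u_A` leaves the integer coordinates unchanged, so such a minor is an
integer. -/
theorem one_le_abs_minor_of_topCount_eq_zero {d n k : ℕ} (h : d < n)
    {A : Matrix (Fin (d + 1)) (Fin (n - d)) ℝ} {x : Fin k → Fin (n + 1) → ℝ}
    (hx : ∀ i, x i ∈ latticeOf (uA h A)) {f : Fin k → Fin (n + 1)} (hf : ∀ a, d < (f a : ℕ))
    (h0 : minor x f ≠ 0) : 1 ≤ |minor x f| := by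
  choose z hz using hx
  have hzf : ∀ i a, x i (f a) = (z i (f a) : ℝ) := by
    intro i a
    obtain ⟨s, hs⟩ := (blockEquiv h).surjective (f a)
    have hfa := hf a
    rw [← hs] at hfa ⊢
    rcases s with b | b
    · exact absurd (blockEquiv_inl_le h b) (not_le.2 hfa)
    · rw [← hz i]
      exact uA_mulVec_inr h A _ b
  have e : minor x f = (((Matrix.of fun i a => z i (f a)).det : ℤ) : ℝ) := by
    rw [minor, Int.cast_det]
    congr 1
    ext i a
    simp [hzf]
  rw [e] at h0 ⊢
  exact_mod_cast Int.one_le_abs (by exact_mod_cast h0)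

/-- If `π_0(v) ≠ 0`, then `‖π_1(v)‖` is bounded below in terms of `‖π_0(v)‖`. -/
theorem exists_pos_forall_mul_rpow_le {d n k : ℕ} (h : d < n)
    {A : Matrix (Fin (d + 1)) (Fin (n - d)) ℝ} (hk : 1 ≤ k) {w : ℝ}
    (hw0 : 0 ≤ w) (hw : diophExp A < (w : EReal)) :
    ∃ c : ℝ, 0 < c ∧ ∀ x : Fin k → Fin (n + 1) → ℝ, (∀ i, x i ∈ latticeOf (uA h A)) →
      LinearIndependent ℝ x → ∀ (J : Set.powersetCard (Fin (n + 1)) k) (P : ℝ),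
      topCount d J.1 = 0 → minor x (Set.powersetCard.ofFinEmbEquiv.symm J) ≠ 0 →
      (∀ K : Set.powersetCard (Fin (n + 1)) k, topCount d K.1 = 0 →
        |minor x (Set.powersetCard.ofFinEmbEquiv.symm K)| ≤
          |minor x (Set.powersetCard.ofFinEmbEquiv.symm J)|) → 0 ≤ P →
      (∀ K : Set.powersetCard (Fin (n + 1)) k, topCount d K.1 = 1 →
        |minor x (Set.powersetCard.ofFinEmbEquiv.symm K)| ≤ P) →
      c * |minor x (Set.powersetCard.ofFinEmbEquiv.symm J)| ^ (1 - (1 + w) / k) ≤ P := by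
  obtain ⟨c, hc0, hc⟩ := exists_pos_le_of_mem_latticeOf h hw0 hw
  have hk1 : (1 : ℝ) ≤ k := by exact_mod_cast hk
  have hk0 : (0 : ℝ) < k := by linarith
  refine ⟨c / (k * (k : ℝ) ^ w), by positivity, fun x hx hli J P hJ hJ0 hmax hP0 hP => ?_⟩
  have hbot : ∀ a, d < (Set.powersetCard.ofFinEmbEquiv.symm J a : ℕ) := by
    intro a
    by_contra hle
    have : (Set.powersetCard.ofFinEmbEquiv.symm J a) ∈
        J.1.filter fun j : Fin (n + 1) => (j : ℕ) ≤ d := by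
      rw [Finset.mem_filter]
      refine ⟨?_, not_lt.1 hle⟩
      exact (Set.powersetCard.mem_coe_iff).2
        ((Set.powersetCard.mem_range_ofFinEmbEquiv_symm_iff_mem J _).1 ⟨a, rfl⟩)
    rw [topCount, Finset.card_eq_zero] at hJ
    rw [hJ] at this
    simp at this
  have hV1 := one_le_abs_minor_of_topCount_eq_zero h hx hbot hJ0
  set g := Set.powersetCard.ofFinEmbEquiv.symm J with hg
  set V := |minor x g| with hV
  have hV0 : 0 < V := by linarith
  obtain ⟨m, hm0, hm⟩ := exists_int_combination_le hk x g hJ0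
  -- Exchanging an index of `J` for a lower one gives a minor at most `V` by maximality. Exchanging
  -- it for an upper one gives a minor with exactly one upper index, hence at most `P`.
  have key := hc _ (sum_int_mul_mem_latticeOf _ hx m) (sum_int_mul_ne_zero hli hm0)
    (k * V ^ (1 / (k : ℝ))) (k * V ^ (1 / (k : ℝ)) * (P / V))
    (by
      have := Real.one_le_rpow hV1 (one_div_nonneg.2 hk0.le)
      nlinarith)
    (by
      intro l hl
      have h2 := hm l V (fun a => by
        rcases minor_eq_zero_or_exists x (Function.update g a l) with h0 | ⟨K, hinj, himg, hK⟩
        · rw [h0, abs_zero]; exact hV0.le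
        · rw [hK]
          apply hmax
          rw [himg, topCount_image hinj, Finset.card_eq_zero, Finset.filter_eq_empty_iff]
          intro b _
          rw [not_le]
          by_cases hb : b = a
          · subst hb; simpa using hl
          · simpa [hb] using hbot b)
      rwa [div_self hV0.ne', mul_one] at h2)
    (by
      intro l hl
      refine hm l P (fun a => ?_)
      rcases minor_eq_zero_or_exists x (Function.update g a l) with h0 | ⟨K, hinj, himg, hK⟩
      · rw [h0, abs_zero]; exact hP0
      · rw [hK]
        apply hP
        rw [himg, topCount_image hinj, Finset.card_eq_one]
        refine ⟨a, ?_⟩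
        ext b
        simp only [Finset.mem_filter, Finset.mem_univ, true_and, Finset.mem_singleton]
        by_cases hb : b = a
        · subst hb; simpa using hl
        · simpa [hb] using hbot b)
  have hkw : 0 < (k : ℝ) ^ w := Real.rpow_pos_of_pos hk0 _
  rw [Real.mul_rpow hk0.le (by positivity), ← Real.rpow_mul hV0.le, Real.rpow_neg hk0.le] at key
  have e : V ^ (1 - (1 + w) / k) = V ^ (1 / (k : ℝ) * -w) * V / V ^ (1 / (k : ℝ)) := by
    have e1 : 1 - (1 + w) / k = 1 / (k : ℝ) * -w + 1 - 1 / k := by field_simp; ring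
    rw [e1, Real.rpow_sub hV0, Real.rpow_add hV0, Real.rpow_one]
  rw [e]
  have hVk : 0 < V ^ (1 / (k : ℝ)) := Real.rpow_pos_of_pos hV0 _
  calc c / (k * (k : ℝ) ^ w) * (V ^ (1 / (k : ℝ) * -w) * V / V ^ (1 / (k : ℝ)))
      = c * (((k : ℝ) ^ w)⁻¹ * V ^ (1 / (k : ℝ) * -w)) * (V / (k * V ^ (1 / (k : ℝ)))) := by
        field_simp
    _ ≤ k * V ^ (1 / (k : ℝ)) * (P / V) * (V / (k * V ^ (1 / (k : ℝ)))) :=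
        mul_le_mul_of_nonneg_right key (by positivity)
    _ = P := by field_simp

/-! ### The height bound in a fixed rank -/

/-- Inserting `V ≈ e^{kt/(n+1)}` into the bound for `π_1` makes `k` cancel, leaving the threshold
`s/(d(n+1))`. -/
theorem rate_pos_of_low_rank {d n k w R : ℝ} (hd : 0 < d + 1) (hn : 0 < n) (hk : 0 < k)
    (h2 : (d + 1) * w - (n - d) < R * d * (n + 1)) :
    0 < k / (n + 1) * (1 - (1 + w) / k) - (k / (n + 1) - R - 1 * (1 - R) / (d + 1)) := by
  have : k / (n + 1) * (1 - (1 + w) / k) - (k / (n + 1) - R - 1 * (1 - R) / (d + 1)) =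
      (R * d * (n + 1) - ((d + 1) * w - (n - d))) / ((n + 1) * (d + 1)) := by
    field_simp
    ring
  rw [this]
  exact div_pos (by linarith) (by positivity)

/-- Inserting `V ≈ e^{(k/(n+1)-R)t}` gives the threshold `ks/((n+1)(s+n+1-k))`, which is largest at
`k = n`, where it equals the small-covolume threshold. -/
theorem rate_pos_of_large_covolume {d n k w R : ℝ} (hd : 0 < d + 1) (hn : 0 < n) (hk : 0 < k)
    (hkn : k ≤ n) (hs : 0 ≤ (d + 1) * w - (n - d))
    (h1 : n * ((d + 1) * w - (n - d)) < R * (1 + ((d + 1) * w - (n - d))) * (n + 1)) :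
    0 < (k / (n + 1) - R) * (1 - (1 + w) / k) - (k / (n + 1) - R - 1 * (1 - R) / (d + 1)) := by
  set s := (d + 1) * w - (n - d) with hsdef
  have hw : w = (s + (n - d)) / (d + 1) := by rw [hsdef]; field_simp; ring
  have e : (k / (n + 1) - R) * (1 - (1 + w) / k) - (k / (n + 1) - R - 1 * (1 - R) / (d + 1)) =
      (R * (n + 1) * (s + n + 1 - k) - k * s) / (k * (n + 1) * (d + 1)) := by
    rw [hw]
    field_simp
    ring
  rw [e]
  refine div_pos ?_ (by positivity)
  have h3 : k * s * (1 + s) ≤ n * s * (s + n + 1 - k) := by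
    have : 0 ≤ s * ((n - k) * (s + (n + 1))) :=
      mul_nonneg hs (mul_nonneg (by linarith) (by linarith))
    nlinarith
  have h4 : n * s * (s + n + 1 - k) < R * (1 + s) * (n + 1) * (s + n + 1 - k) :=
    mul_lt_mul_of_pos_right h1 (by linarith)
  have h5 : 0 < (R * (n + 1) * (s + n + 1 - k) - k * s) * (1 + s) := by nlinarith
  exact pos_of_mul_pos_left h5 (by linarith)

theorem exp_le_div_of_rpow_le {c E V u p β t : ℝ} (hc : 0 < c) (hE : 0 < E)
    (hV : (E * Real.exp (u * t)) ^ p ≤ V ^ p) (hP : c * V ^ p ≤ E * Real.exp (β * t)) :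
    Real.exp ((u * p - β) * t) ≤ E / (c * E ^ p) := by
  have hEp : 0 < E ^ p := Real.rpow_pos_of_pos hE p
  rw [le_div_iff₀ (by positivity)]
  rw [Real.mul_rpow hE.le (Real.exp_pos _).le, ← Real.exp_mul] at hV
  have h1 := (mul_le_mul_of_nonneg_left hV hc.le).trans hP
  have h2 := mul_le_mul_of_nonneg_right h1 (Real.exp_pos (-(β * t))).le
  have h3 : Real.exp (β * t) * Real.exp (-(β * t)) = 1 := by rw [← Real.exp_add]; simp
  have h4 : Real.exp ((u * p - β) * t) = Real.exp (u * t * p) * Real.exp (-(β * t)) := by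
    rw [← Real.exp_add]; ring_nf
  calc Real.exp ((u * p - β) * t) * (c * E ^ p)
      = c * (E ^ p * Real.exp (u * t * p)) * Real.exp (-(β * t)) := by rw [h4]; ring
    _ ≤ _ := h2
    _ = E := by rw [mul_assoc, h3, mul_one]

/-- The bound for the contribution of the rank `k` sublattices to the height. -/
theorem eventually_phi_le {d n k : ℕ} (h : d < n) {ε : ℝ} (hε : 0 < ε)
    {A : Matrix (Fin (d + 1)) (Fin (n - d)) ℝ} (hk : 1 ≤ k) (hkn : k ≤ n) {w R R₀ : ℝ}
    (hw0 : 0 ≤ w) (hw : diophExp A < (w : EReal)) (hR₀ : 0 ≤ R₀) (hR₀R : R₀ ≤ R)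
    (hRn : R₀ * ((n : ℝ) + 1) ≤ n) (hs : 0 ≤ ((d : ℝ) + 1) * w - (n - d))
    (h1 : (n : ℝ) * (((d : ℝ) + 1) * w - (n - d)) <
      R₀ * (1 + (((d : ℝ) + 1) * w - (n - d))) * ((n : ℝ) + 1))
    (h2 : ((d : ℝ) + 1) * w - (n - d) < R * d * ((n : ℝ) + 1)) :
    ∀ᶠ t : ℝ in atTop, ∀ y : Fin k → Fin (n + 1) → ℝ,
      (∀ i, y i ∈ latticeOf (bt h t * uA h A)) → LinearIndependent ℝ y →
      phi d ε (exteriorPower.ιMulti ℝ k y) ≤ ENNReal.ofReal (Real.exp (R * t)) := by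
  have hk0 : (0 : ℝ) < k := by exact_mod_cast hk
  have hkn' : (k : ℝ) ≤ n := by exact_mod_cast hkn
  have hn0 : (0 : ℝ) < n := by linarith
  obtain ⟨c, hc0, hc⟩ := exists_pos_forall_mul_rpow_le h (A := A) hk hw0 hw
  set E := max 1 (ε ^ del n k) with hEdef
  have hE : 1 ≤ E := le_max_left _ _
  have hE0 : 0 < E := by linarith
  have r1 := rate_pos_of_low_rank (d := d) (n := n) (by positivity) hn0 hk0 h2
  have r2 := rate_pos_of_large_covolume (d := d) (n := n) (by positivity) hn0 hk0 hkn' hs h1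
  set p := 1 - (1 + w) / k with hp
  filter_upwards [eventually_ge_atTop 0,
    eventually_exists_lt_minor h hk hkn hw0 hw hE hR₀ hRn h1,
    eventually_const_lt_exp_mul (E / (c * E ^ p)) r1,
    eventually_const_lt_exp_mul (E / (c * E ^ p)) r2] with t ht0 hA ht1 ht2 y hy hli
  by_contra! hphi
  choose x hxL hyx using fun i => mem_latticeOf_mul _ _ _ (hy i)
  have hyx' : y = fun i l => dil d n t l * x i l := by
    ext i l
    rw [hyx, bt_mulVec]
  have hxli : LinearIndependent ℝ x := by
    refine LinearIndependent.of_comp (Matrix.mulVecLin (bt h t).1) ?_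
    convert hli using 1
    ext i l
    simp [hyx]
  have hcoord : ∀ J : Set.powersetCard (Fin (n + 1)) k,
      |minor x (Set.powersetCard.ofFinEmbEquiv.symm J)| ≤
        E * Real.exp ((if topCount d J.1 = 0 then k / ((n : ℝ) + 1) else k / ((n : ℝ) + 1) - R -
          (topCount d J.1 : ℝ) * (1 - R) / ((d : ℝ) + 1)) * t) := by
    intro J
    have h3 := abs_repr_le_of_lt_phi hε hphi J
    rw [eBasis_repr_ιMulti, hyx', minor_dil, abs_mul, abs_of_pos (Real.exp_pos _),
      ← le_div_iff₀' (Real.exp_pos _), div_eq_mul_inv, ← Real.exp_neg, mul_assoc,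
      ← Real.exp_add] at h3
    refine h3.trans_eq ?_
    congr 2
    split_ifs with h0
    · rw [h0]; push_cast; ring
    · ring
  have hmono : ∀ J : Set.powersetCard (Fin (n + 1)) k,
      k / ((n : ℝ) + 1) - R - (topCount d J.1 : ℝ) * (1 - R) / ((d : ℝ) + 1) ≤
      k / ((n : ℝ) + 1) - R₀ - (topCount d J.1 : ℝ) * (1 - R₀) / ((d : ℝ) + 1) := by
    intro J
    have h3 : (topCount d J.1 : ℝ) / ((d : ℝ) + 1) ≤ 1 := by
      rw [div_le_one (by positivity)]
      exact_mod_cast topCount_le d J.1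
    have h4 := mul_nonneg (sub_nonneg.2 hR₀R) (sub_nonneg.2 h3)
    have h5 : ∀ a : ℝ, (topCount d J.1 : ℝ) * a / ((d : ℝ) + 1) =
      (topCount d J.1 : ℝ) / ((d : ℝ) + 1) * a := fun a => by ring
    rw [h5, h5]
    nlinarith
  -- Some coordinate escapes the uniform decay law, and the height bound allows this only for `i =
  -- 0`.
  obtain ⟨J₁, hJ₁⟩ := hA x hxL hxli
  have hJ₁0 : topCount d J₁.1 = 0 := by
    by_contra h0
    have h3 := hcoord J₁
    rw [if_neg h0] at h3
    have h4 : E * Real.exp ((k / ((n : ℝ) + 1) - R -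
        (topCount d J₁.1 : ℝ) * (1 - R) / ((d : ℝ) + 1)) * t) ≤
        E * Real.exp ((k / ((n : ℝ) + 1) - R₀ -
          (topCount d J₁.1 : ℝ) * (1 - R₀) / ((d : ℝ) + 1)) * t) :=
      mul_le_mul_of_nonneg_left
        (Real.exp_le_exp.2 (mul_le_mul_of_nonneg_right (hmono J₁) ht0)) hE0.le
    linarith
  rw [hJ₁0] at hJ₁
  have hJ₁ne : minor x (Set.powersetCard.ofFinEmbEquiv.symm J₁) ≠ 0 :=
    abs_pos.1 (lt_trans (mul_pos hE0 (Real.exp_pos _)) hJ₁)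
  obtain ⟨J, hJ, hJne, hJ₁J, hmax⟩ :=
    exists_minor_maximal x (fun J => topCount d J.1 = 0) J₁ hJ₁0 hJ₁ne
  have hlow := hJ₁.trans_le hJ₁J
  have hup := hcoord J
  rw [if_pos hJ] at hup
  have hV0 : 0 < |minor x (Set.powersetCard.ofFinEmbEquiv.symm J)| := abs_pos.2 hJne
  have hP : ∀ K : Set.powersetCard (Fin (n + 1)) k, topCount d K.1 = 1 →
      |minor x (Set.powersetCard.ofFinEmbEquiv.symm K)| ≤
        E * Real.exp ((k / ((n : ℝ) + 1) - R - 1 * (1 - R) / ((d : ℝ) + 1)) * t) := by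
    intro K hK
    have h3 := hcoord K
    rwa [if_neg (by omega), hK, Nat.cast_one] at h3
  have hP₀ : ∀ K : Set.powersetCard (Fin (n + 1)) k, topCount d K.1 = 1 →
      |minor x (Set.powersetCard.ofFinEmbEquiv.symm K)| ≤
        E * Real.exp ((k / ((n : ℝ) + 1) - R₀ - 1 * (1 - R₀) / ((d : ℝ) + 1)) * t) := by
    intro K hK
    have h3 := hmono K
    rw [hK, Nat.cast_one] at h3
    exact (hP K hK).trans (mul_le_mul_of_nonneg_left
      (Real.exp_le_exp.2 (mul_le_mul_of_nonneg_right h3 ht0)) hE0.le)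
  -- The sign of `p` decides which bound on `V` bounds `V ^ p` from below: the upper one if `k ≤ 1 +
  -- w`, otherwise the lower one, whose rate is `R₀`.
  rcases le_or_gt p 0 with hp0 | hp0
  · have h3 := hc x hxL hxli J _ hJ hJne hmax (mul_pos hE0 (Real.exp_pos _)).le hP
    exact absurd (exp_le_div_of_rpow_le hc0 hE0
      (Real.rpow_le_rpow_of_nonpos hV0 hup hp0) h3) (not_le.2 ht1)
  · have h3 := hc x hxL hxli J _ hJ hJne hmax (mul_pos hE0 (Real.exp_pos _)).le hP₀
    have hlow' : E * Real.exp ((k / ((n : ℝ) + 1) - R₀) * t) ≤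
        |minor x (Set.powersetCard.ofFinEmbEquiv.symm J)| := by
      simpa using hlow.le
    exact absurd (exp_le_div_of_rpow_le hc0 hE0
      (Real.rpow_le_rpow (by positivity) hlow' hp0.le) h3) (not_le.2 ht2)

/-! ### From `φ` to the growth exponent `ρ` -/

theorem lattice_smul_mk {n : ℕ} (g g' : G n) :
    lattice (g • (QuotientGroup.mk g' : X n)) = latticeOf (g * g') := rfl

theorem eventually_alpha_le {d n : ℕ} (h : d < n) {ε θ R : ℝ} (hθ : 0 < θ)
    {A : Matrix (Fin (d + 1)) (Fin (n - d)) ℝ}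
    (hphi : ∀ k, 1 ≤ k → k ≤ n → ∀ᶠ t : ℝ in atTop, ∀ y : Fin k → Fin (n + 1) → ℝ,
      (∀ i, y i ∈ latticeOf (bt h t * uA h A)) → LinearIndependent ℝ y →
      phi d ε (exteriorPower.ιMulti ℝ k y) ≤ ENNReal.ofReal (Real.exp (R * t))) :
    ∀ᶠ t : ℝ in atTop, alpha d ε θ (bt h t • (QuotientGroup.mk (uA h A) : X n)) ≤
      ENNReal.ofReal (Real.exp (R * θ * t)) := by
  have hall : ∀ᶠ t : ℝ in atTop, ∀ k ∈ Finset.Icc 1 n, ∀ y : Fin k → Fin (n + 1) → ℝ,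
      (∀ i, y i ∈ latticeOf (bt h t * uA h A)) → LinearIndependent ℝ y →
      phi d ε (exteriorPower.ιMulti ℝ k y) ≤ ENNReal.ofReal (Real.exp (R * t)) := by
    rw [Filter.eventually_all_finset]
    intro k hk
    rw [Finset.mem_Icc] at hk
    exact hphi k hk.1 hk.2
  filter_upwards [hall] with t ht
  refine iSup_le fun k => iSup_le fun hk => iSup_le fun y => iSup_le fun hy => ?_
  refine (ENNReal.rpow_le_rpow (ht k (Finset.mem_Icc.2 hk) y ?_ hy.2) hθ.le).trans_eq ?_
  · intro i
    have := hy.1 i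
    rwa [lattice_smul_mk] at this
  · rw [ENNReal.ofReal_rpow_of_pos (Real.exp_pos _), ← Real.exp_mul]
    ring_nf

theorem rho_le_of_eventually_alpha_le {d n : ℕ} (h : d < n) {ε θ r : ℝ} {y : X n}
    (hα : ∀ᶠ t : ℝ in atTop, alpha d ε θ (bt h t • y) ≤ ENNReal.ofReal (Real.exp (r * t))) :
    rho h ε θ y ≤ (r : EReal) := by
  refine limsup_le_of_le (h := ?_)
  filter_upwards [hα, eventually_gt_atTop 0] with t ht ht0
  have h1 := ENNReal.log_le_log_iff.2 ht
  rw [ENNReal.log_ofReal_of_pos (Real.exp_pos _), Real.log_exp] at h1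
  rw [EReal.div_le_iff_le_mul (by exact_mod_cast ht0) (EReal.coe_ne_top _)]
  refine h1.trans_eq ?_
  rw [← EReal.coe_mul, mul_comm]

/-- The growth exponent of the height along `b_t y_A` is at most the larger of the two rates. -/
theorem rho_le_max {d n : ℕ} (hd : 1 ≤ d) (h : d < n) {ε θ : ℝ} (hε : 0 < ε) (hθ : 0 < θ)
    {A : Matrix (Fin (d + 1)) (Fin (n - d)) ℝ} {ω : ℝ} (hA : diophExp A = (ω : EReal))
    (hω : ((n : ℝ) - d) / ((d : ℝ) + 1) ≤ ω) :
    rho h ε θ (QuotientGroup.mk (uA h A)) ≤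
      ((max ((n : ℝ) * (((d : ℝ) + 1) * ω - (n - d)) /
          ((1 + (((d : ℝ) + 1) * ω - (n - d))) * ((n : ℝ) + 1)))
        ((((d : ℝ) + 1) * ω - (n - d)) / (d * ((n : ℝ) + 1))) * θ : ℝ) : EReal) := by
  have hd0 : (0 : ℝ) < d := by exact_mod_cast hd
  have hdn : (d : ℝ) < n := by exact_mod_cast h
  have hn0 : (0 : ℝ) < n := by linarith
  have hω0 : 0 ≤ ω := (div_nonneg (by linarith) (by linarith)).trans hω
  have hs : 0 ≤ ((d : ℝ) + 1) * ω - (n - d) := by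
    rw [div_le_iff₀ (by linarith)] at hω
    linarith
  set M := max ((n : ℝ) * (((d : ℝ) + 1) * ω - (n - d)) /
          ((1 + (((d : ℝ) + 1) * ω - (n - d))) * ((n : ℝ) + 1)))
        ((((d : ℝ) + 1) * ω - (n - d)) / (d * ((n : ℝ) + 1))) with hM
  have key : ∀ R : ℝ, M < R → rho h ε θ (QuotientGroup.mk (uA h A)) ≤ ((R * θ : ℝ) : EReal) := by
    intro R hR
    have hR1 := (le_max_left _ _).trans_lt hR
    have hR2 := (le_max_right _ _).trans_lt hR
    have hR0 : 0 < R := lt_of_le_of_lt (by positivity) hR2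
    rw [div_lt_iff₀ (by positivity)] at hR1 hR2
    -- The small-covolume argument needs a rate at most `n/(n+1)`. Truncation is harmless, as the
    -- first threshold is strictly below `n/(n+1)`.
    set R₀ := min R (n / ((n : ℝ) + 1)) with hR₀
    have hlim1 : (n : ℝ) * (((d : ℝ) + 1) * ω - (n - d)) <
        R₀ * (1 + (((d : ℝ) + 1) * ω - (n - d))) * ((n : ℝ) + 1) := by
      rcases min_choice R (n / ((n : ℝ) + 1)) with h3 | h3
      · rw [hR₀, h3]; linarith
      · rw [hR₀, h3]
        have : (n : ℝ) / ((n : ℝ) + 1) * (1 + (((d : ℝ) + 1) * ω - (n - d))) * ((n : ℝ) + 1) =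
          n * (1 + (((d : ℝ) + 1) * ω - (n - d))) := by field_simp
        rw [this]
        nlinarith
    have hlim2 : ((d : ℝ) + 1) * ω - (n - d) < R * d * ((n : ℝ) + 1) := by linarith
    have e1 : ∀ᶠ w in nhdsWithin ω (Set.Ioi ω), (n : ℝ) * (((d : ℝ) + 1) * w - (n - d)) <
        R₀ * (1 + (((d : ℝ) + 1) * w - (n - d))) * ((n : ℝ) + 1) :=
      nhdsWithin_le_nhds (((by fun_prop : Continuous fun w : ℝ =>
        (n : ℝ) * (((d : ℝ) + 1) * w - (n - d))).tendsto ω).eventually_lt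
        ((by fun_prop : Continuous fun w : ℝ =>
          R₀ * (1 + (((d : ℝ) + 1) * w - (n - d))) * ((n : ℝ) + 1)).tendsto ω) hlim1)
    have e2 : ∀ᶠ w in nhdsWithin ω (Set.Ioi ω),
        ((d : ℝ) + 1) * w - (n - d) < R * d * ((n : ℝ) + 1) :=
      nhdsWithin_le_nhds (((by fun_prop : Continuous fun w : ℝ =>
        ((d : ℝ) + 1) * w - (n - d)).tendsto ω).eventually_lt tendsto_const_nhds hlim2)
    -- Both strict inequalities are open conditions, so they persist for some `w` slightly above the
    -- exponent.
    obtain ⟨w, ⟨hw1, hw2⟩, hw⟩ := ((e1.and e2).and self_mem_nhdsWithin).exists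
    have hw' : ω < w := hw
    refine rho_le_of_eventually_alpha_le h (eventually_alpha_le h hθ fun k hk hkn =>
      eventually_phi_le h hε hk hkn (hω0.trans hw'.le) ?_
        (le_min hR0.le (by positivity)) (min_le_left _ _) ?_ ?_ hw1 hw2)
    · rw [hA]; exact EReal.coe_lt_coe_iff.2 hw'
    · exact (le_div_iff₀ (by positivity)).1 (min_le_right R (n / ((n : ℝ) + 1)))
    · nlinarith
  have hlim : Tendsto (fun R : ℝ => ((R * θ : ℝ) : EReal)) (nhdsWithin M (Set.Ioi M))
      (nhds ((M * θ : ℝ) : EReal)) :=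
    ((continuous_coe_real_ereal.comp (continuous_id.mul continuous_const)).tendsto M).mono_left
      nhdsWithin_le_nhds
  exact ge_of_tendsto hlim (by
    filter_upwards [self_mem_nhdsWithin] with R hR using key R hR)

end AffineSing

end

/-! ### Comparison of the two rates -/

theorem proposition4p1 (d n : ℕ) (hd : 1 ≤ d) (hdn : d < n)
    (θ ε : ℝ) (hθ0 : 0 < θ) (hθ : θ < (d : ℝ) / ((d : ℝ) + 1)) (hε : 0 < ε)
    (A : Matrix (Fin (d + 1)) (Fin (n - d)) ℝ)
    (hA : AffineSing.diophExp A < ((n : ℝ) : EReal)) :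
    ∃ ω : ℝ, AffineSing.diophExp A = (ω : EReal) ∧
      ((n : ℝ) - d) / ((d : ℝ) + 1) ≤ ω ∧
      (ω < (n : ℝ) - 1 →
        AffineSing.rho hdn ε θ (QuotientGroup.mk (AffineSing.uA hdn A)) ≤
          ((((n : ℝ) * ((d : ℝ) + 1) * (ω - ((n : ℝ) - d) / ((d : ℝ) + 1))) /
            ((1 + ((d : ℝ) + 1) * ω - ((n : ℝ) - d)) * ((n : ℝ) + 1)) * θ : ℝ) : EReal)) ∧
      ((n : ℝ) - 1 ≤ ω →
        AffineSing.rho hdn ε θ (QuotientGroup.mk (AffineSing.uA hdn A)) ≤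
          (((ω - ((n : ℝ) - d) / ((d : ℝ) + 1)) *
            (((d : ℝ) + 1) / ((d : ℝ) * ((n : ℝ) + 1))) * θ : ℝ) : EReal)) := by
  have hlow := AffineSing.le_diophExp hdn A
  obtain ⟨ω, hω⟩ : ∃ ω : ℝ, AffineSing.diophExp A = (ω : EReal) :=
    ⟨_, (EReal.coe_toReal (hA.trans (EReal.coe_lt_top _)).ne
      ((EReal.bot_lt_coe _).trans_le hlow).ne').symm⟩
  have hωlow : ((n : ℝ) - d) / ((d : ℝ) + 1) ≤ ω := by
    rw [hω] at hlow
    exact EReal.coe_le_coe_iff.1 hlow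
  have hmax := AffineSing.rho_le_max hd hdn hε hθ0 hω hωlow
  have hd0 : (0 : ℝ) < d := by exact_mod_cast hd
  have hn0 : (0 : ℝ) < n := by
    have : (d : ℝ) < n := by exact_mod_cast hdn
    linarith
  have hs : 0 ≤ ((d : ℝ) + 1) * ω - (n - d) := by
    have := (div_le_iff₀ (by linarith : (0 : ℝ) < (d : ℝ) + 1)).1 hωlow
    linarith
  have e1 : (n : ℝ) * (((d : ℝ) + 1) * ω - (n - d)) /
        ((1 + (((d : ℝ) + 1) * ω - (n - d))) * ((n : ℝ) + 1)) =
      (n : ℝ) * ((d : ℝ) + 1) * (ω - ((n : ℝ) - d) / ((d : ℝ) + 1)) /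
        ((1 + ((d : ℝ) + 1) * ω - ((n : ℝ) - d)) * ((n : ℝ) + 1)) := by
    congr 1
    · field_simp
    · ring
  have e2 : (((d : ℝ) + 1) * ω - (n - d)) / (d * ((n : ℝ) + 1)) =
      (ω - ((n : ℝ) - d) / ((d : ℝ) + 1)) *
        (((d : ℝ) + 1) / ((d : ℝ) * ((n : ℝ) + 1))) := by
    field_simp
  refine ⟨ω, hω, hωlow, fun hlt => ?_, fun hge => ?_⟩
  · rw [max_eq_left, e1] at hmax
    · exact hmax
    · rw [div_le_div_iff₀ (by positivity) (by positivity)]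
      -- With `s = (d+1)ω - (n-d)`, the first rate dominates as soon as `nd ≥ 1 + s`, and `nd - (1 +
      -- s) = (d+1)(n-1-ω)`.
      have : 0 ≤ (((d : ℝ) + 1) * ω - (n - d)) * ((n + 1) *
          (((d : ℝ) + 1) * ((n : ℝ) - 1 - ω))) :=
        mul_nonneg hs (mul_nonneg (by positivity) (mul_nonneg (by positivity) (by linarith)))
      nlinarith
  · rw [max_eq_right, e2] at hmax
    · exact hmax
    · rw [div_le_div_iff₀ (by positivity) (by positivity)]
      have : 0 ≤ (((d : ℝ) + 1) * ω - (n - d)) * ((n + 1) *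
          (((d : ℝ) + 1) * (ω - ((n : ℝ) - 1)))) :=
        mul_nonneg hs (mul_nonneg (by positivity) (mul_nonneg (by positivity) (by linarith)))
      nlinarith
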